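/- **Setting.** Let $X$ be a finite or countably infinite set, let $C$ be a class of functions $c:X\to\{0,1\}$ of finite VC dimension $d$, and let $n\ge 1$. For a probability distribution $D$ on $X$, functions $f,h:X\to\{0,1\}$ and $S\subseteq X$, put $\mathrm{rej}_D(S)=\Pr_{x\sim D}[x\notin S]$ and $\mathrm{err}_D(h|_S)=\Pr_{x\sim D}[h(x)\ne f(x)\wedge x\in S]$. For $z\in X^n$ and $g:X\to\{0,1\}$ put $\mathrm{err}_z(h|_S,g)=\frac1n|\{i: g(z_i)\neq h(z_i)\wedge z_i\in S\}|$, and $\mathrm{err}_z(h,g)=\mathrm{err}_z(h|_X,g)$. Let $\mathrm{ERM}$ be any deterministic oracle that, given a finite list of labelled examples from $X\times\{0,1\}$, returns a member of $C$ making the fewest mistakes on it. **Rejectron**$(x,y,\tilde x,\varepsilon)$, for $x,\tilde x\in X^n$, $y\in\{0,1\}^n$, with weight $\Lambda=n+1$: set $h=\mathrm{ERM}(x,y)$. For $t=1,2,\dots$: let $S_t=\{u\in X: h(u)=c_1(u)=\dots=c_{t-1}(u)\}$; choose $c_t\in C$ maximizing $s_t(c)=\mathrm{err}_{\tilde x}(h|_{S_t},c)-\Lambda\,\mathrm{err}_x(h,c)$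 over $c\in C$ (by any fixed deterministic rule); if $s_t(c_t)\le\varepsilon$, stop and return $h|_{S_t}$, i.e. the pair $(h,S_t)$. **Theorem.** Let $f\in C$, let $P,Q$ be probability distributions on $X$, and let $\delta>0$. Write $f(x)=(f(x_1),\dots,f(x_n))$; in each event below, "Rejectron halts" is part of the event and $h|_S$ denotes its output. 1. Let $\varepsilon^*=\sqrt{\dfrac{8d\ln(2n)}{n}}+\dfrac{8\ln(16/\delta)}{n}$ and $h|_S=\mathrm{Rejectron}(x,f(x),\tilde x,\varepsilon^*)$. Then $$\Pr_{x\sim P^n,\ \tilde x\sim Q^n}\big[\mathrm{err}_Q(h|_S)\le 2\varepsilon^*\ \wedge\ \mathrm{rej}_P(S)\le\varepsilon^*\big]\ \ge\ 1-\delta .$$ 2. (General trade-off.) With $h|_S=\mathrm{Rejectron}(x,f(x),\tilde x,\varepsilon)$: (a) for every $\varepsilon\ge\sqrt{\dfrac{8d\ln(2n)}{n}}+\dfrac{8\ln(8/\delta)}{n}$ and every $x\in X^n$, $$\Pr_{\tilde x\sim Q^n}\big[\mathrm{err}_Q(h|_S)\le 2\varepsilon\big]\ge 1-\delta ;$$ (b)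 for every $\varepsilon>0$, $$\Pr_{x\sim P^n}\Big[\forall\tilde x\in X^n:\ \mathrm{rej}_P(S)\le\frac2n\Big(\frac{2d}{\varepsilon}\log_2(2n)+\log_2\frac2\delta\Big)\Big]\ge 1-\delta .$$ -/

import Mathlib

open MeasureTheory

namespace PQ

noncomputable section

/-- `C` shatters the finite set `A`: every labelling of `A` is realised by a member of `C`. -/
def Shatters {X : Type*} (C : Set (X → Bool)) (A : Finset X) : Prop :=
  ∀ g : X → Bool, ∃ c ∈ C, ∀ a ∈ A, c a = g a

/-- The Vapnik-Chervonenkis dimension of a class of binary classifiers (possibly infinite). -/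
def vcDim {X : Type*} (C : Set (X → Bool)) : ℕ∞ :=
  ⨆ (A : Finset X) (_ : Shatters C A), (A.card : ℕ∞)

/-- Rejection rate of the selection set `S` on the distribution `D`. -/
def rej {X : Type*} [MeasurableSpace X] (D : Measure X) (S : Set X) : ℝ :=
  D.real {x | x ∉ S}

/-- Error rate on `D` of the selective classifier `h|_S` with respect to the target `f`. -/
def err {X : Type*} [MeasurableSpace X] (D : Measure X) (f h : X → Bool) (S : Set X) : ℝ :=
  D.real {x | h x ≠ f x ∧ x ∈ S}

open Classical in
/-- Empirical error of the selective classifier `h|_S` with respect to `g` on the sample `z`. -/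
def empErr {X : Type*} {n : ℕ} (z : Fin n → X) (h : X → Bool) (S : Set X) (g : X → Bool) : ℝ :=
  (1 / (n : ℝ)) * (Finset.univ.filter fun i => g (z i) ≠ h (z i) ∧ z i ∈ S).card

/-- Number of mistakes of `c` on a list of labelled examples. -/
def mistakes {X : Type*} (c : X → Bool) (data : List (X × Bool)) : ℕ :=
  data.countP fun p => c p.1 != p.2

/-- `erm` is a (deterministic) empirical risk minimization oracle for `C`: on any list of labelled
examples it returns a member of `C` with the fewest mistakes. -/
def IsERM {X : Type*} (C : Set (X → Bool)) (erm : List (X × Bool) → X → Bool) : Prop :=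
  ∀ data, erm data ∈ C ∧ ∀ c ∈ C, mistakes (erm data) data ≤ mistakes c data

/-- The set of points on which `h` and all the classifiers in the list `cs` agree. -/
def agreeSet {X : Type*} (h : X → Bool) (cs : List (X → Bool)) : Set X :=
  {x | ∀ c ∈ cs, c x = h x}

/-- The objective `s_t(c)` of an iteration, for train sample `x`, test sample `x'` and current
selection set `S = S_t`. -/
def score {X : Type*} {n : ℕ} (Λ : ℝ) (x x' : Fin n → X) (h : X → Bool) (S : Set X)
    (c : X → Bool) : ℝ :=
  empErr x' h S c - Λ * empErr x h Set.univ c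

/-- A deterministic rule for the choices made in the loop. Its arguments are the train sample, the
test sample, the classifier `h`, and the list `c_1, …, c_{t-1}` of the earlier choices; its value
is the choice `c_t`. -/
abbrev Rule (X : Type*) (n : ℕ) : Type _ :=
  (Fin n → X) → (Fin n → X) → (X → Bool) → List (X → Bool) → (X → Bool)

/-- The rule always picks a maximizer over `C` of the current objective (ties being broken in an
arbitrary way, and by an arbitrary implementation). -/
def IsMaximizing {X : Type*} {n : ℕ} (C : Set (X → Bool)) (Λ : ℝ) (pick : Rule X n) : Prop :=
  ∀ x x' h cs, pick x x' h cs ∈ C ∧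
    ∀ c ∈ C, score Λ x x' h (agreeSet h cs) c ≤ score Λ x x' h (agreeSet h cs) (pick x x' h cs)

/-- The list `c_1, …, c_t` of the first `t` choices. -/
def choices {X : Type*} {n : ℕ} (pick : Rule X n) (x x' : Fin n → X) (h : X → Bool) :
    ℕ → List (X → Bool)
  | 0 => []
  | t + 1 => choices pick x x' h t ++ [pick x x' h (choices pick x x' h t)]

/-- The stopping test passes right after `t` unsuccessful iterations, i.e. in iteration `t + 1`,
where the current selection set is the agreement set of `h, c_1, …, c_t`. -/
def Stops {X : Type*} {n : ℕ} (pick : Rule X n) (Λ ε : ℝ) (x x' : Fin n → X) (h : X → Bool)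
    (t : ℕ) : Prop :=
  score Λ x x' h (agreeSet h (choices pick x x' h t))
    (pick x x' h (choices pick x x' h t)) ≤ ε

open Classical in
/-- The algorithm Rejectron, on train sample `x` with labels `y`, test sample `x'`, error
parameter `ε` and weight `Λ`. It is a partial value: it is defined if and only if the loop halts,
and then it is the pair `(h, S)` returned in the first iteration that passes the stopping test. -/
def rejectron {X : Type*} {n : ℕ} (erm : List (X × Bool) → X → Bool) (pick : Rule X n)
    (Λ : ℝ) (x : Fin n → X) (y : Fin n → Bool) (x' : Fin n → X) (ε : ℝ) :
    Part ((X → Bool) × Set X) :=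
  let h := erm (List.ofFn fun i => (x i, y i))
  ⟨∃ t, Stops pick Λ ε x x' h t, fun H => (h, agreeSet h (choices pick x x' h (Nat.find H)))⟩

/-- The value of the error parameter that balances errors and rejections. -/
def epsStar (d n : ℕ) (δ : ℝ) : ℝ :=
  √(8 * d * Real.log (2 * n) / n) + 8 * Real.log (16 / δ) / n

end

end PQ

namespace PQ

/-! On realizable data `h` agrees with `f` on the training points. With weight n + 1, one training
disagreement with `h` outweighs any gain on the test sample, so an iteration that continues removes
no training point, but more than an ε fraction of the test points. Hence at most 1 / ε classifiers
are chosen, and at the stopping time `f`, a competitor of zero penalty, certifies empirical test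
error at most ε (`rejectron_spec`).

The output is thus built from few members of `C`, and the traces of all such outputs on 2n points
are controlled by Sauer-Shelah (`traceBound_of_vcDim`, `TraceBound.combine`). Generalization is
`measureReal_mul_le_of_traceBound`, an exponential-moment double-sample argument: hits weigh β in
the sample and α in a ghost sample, with α + β = 2. Averaged over exchanges of the two copies, each
trace weighs at most 1, whereas a bad sample forces a large expected weight over the ghost. Taking
(α, β) = (2, 0) bounds rejections, since no training point is rejected; (4/3, 2/3) bounds errors. -/

/-! ### Counting traces -/

theorem sum_range_choose_le_pow (m d : ℕ) :
    ∑ k ∈ Finset.range (d + 1), m.choose k ≤ (m + 1) ^ d := by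
  induction d with
  | zero => simp
  | succ d ih =>
    rw [Finset.sum_range_succ]
    have h1 : m.choose (d + 1) ≤ m ^ (d + 1) := Nat.choose_le_pow _ _
    have h2 : m ^ (d + 1) ≤ m * (m + 1) ^ d := by
      rw [pow_succ']
      gcongr
      omega
    calc _ ≤ (m + 1) ^ d + m * (m + 1) ^ d := by omega
      _ = (m + 1) ^ (d + 1) := by ring

/-- The class `𝒢` has at most `M` traces on every family of points indexed by `ι`. -/
def TraceBound {X : Type*} (𝒢 : Set (X → Bool)) (ι : Type*) (M : ℕ) : Prop :=
  ∀ w : ι → X, ((fun c => c ∘ w) '' 𝒢).ncard ≤ M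

theorem card_le_of_shatters {X : Type*} {C : Set (X → Bool)} {d : ℕ} (hd : vcDim C = (d : ℕ∞))
    {A : Finset X} (hA : Shatters C A) : A.card ≤ d := by
  have h : (A.card : ℕ∞) ≤ vcDim C :=
    le_iSup₂ (f := fun (A : Finset X) (_ : Shatters C A) => (A.card : ℕ∞)) A hA
  rw [hd] at h
  exact_mod_cast h

/-- The Sauer-Shelah lemma for traces on indexed families of points. -/
theorem traceBound_of_vcDim {X : Type*} {C : Set (X → Bool)} {d : ℕ}
    (hd : vcDim C = (d : ℕ∞)) (ι : Type*) [Fintype ι] :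
    TraceBound C ι ((Fintype.card ι + 1) ^ d) := by
  classical
  intro w
  set T : Finset (ι → Bool) := (Set.toFinite ((fun c => c ∘ w) '' C)).toFinset with hT
  have hmem : ∀ t, t ∈ T ↔ ∃ c ∈ C, c ∘ w = t := fun t => by simp [hT]
  let e : (ι → Bool) → Finset ι := fun t => Finset.univ.filter fun i => t i = true
  have he : Function.Injective e := fun s t h => by
    funext i
    have := congrArg (i ∈ ·) h
    simp only [e, Finset.mem_filter, Finset.mem_univ, true_and, eq_iff_iff] at this
    exact Bool.eq_iff_iff.2 this
  have hdim : (T.image e).vcDim ≤ d := by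
    refine Finset.sup_le fun J hJ => ?_
    rw [Finset.mem_shatterer] at hJ
    have key : ∀ s ⊆ J, ∃ c ∈ C, ∀ j ∈ J, c (w j) = true ↔ j ∈ s := by
      intro s hs
      obtain ⟨u, hu, hus⟩ := hJ hs
      obtain ⟨t, ht, rfl⟩ := Finset.mem_image.1 hu
      obtain ⟨c, hc, rfl⟩ := (hmem t).1 ht
      refine ⟨c, hc, fun j hj => ?_⟩
      rw [← hus]
      simp [e, hj]
    -- The points may repeat, but not along a shattered index set: realizing {i} separates `w i`
    -- from the other points.
    have hinj : Set.InjOn w J := by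
      intro i hi j hj hij
      obtain ⟨c, -, hc⟩ := key {i} (by simpa using hi)
      have h1 := (hc i hi).2 (by simp)
      rw [hij] at h1
      exact (show j = i by simpa using (hc j hj).1 h1).symm
    rw [← Finset.card_image_of_injOn hinj]
    refine card_le_of_shatters hd fun g => ?_
    obtain ⟨c, hc, hcs⟩ := key (J.filter fun j => g (w j) = true) (Finset.filter_subset _ _)
    refine ⟨c, hc, fun a ha => ?_⟩
    obtain ⟨j, hj, rfl⟩ := Finset.mem_image.1 ha
    have := hcs j hj
    simp only [Finset.mem_filter, hj, true_and] at this
    exact Bool.eq_iff_iff.2 this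
  calc ((fun c => c ∘ w) '' C).ncard = T.card := Set.ncard_eq_toFinset_card _ _
    _ = (T.image e).card := (Finset.card_image_of_injective _ he).symm
    _ ≤ _ := Finset.card_le_card_shatterer _
    _ ≤ _ := Finset.card_shatterer_le_sum_vcDim
    _ ≤ ∑ k ∈ Finset.range (d + 1), (Fintype.card ι).choose k := by
      refine Finset.sum_le_sum_of_subset fun k hk => ?_
      have := (Finset.mem_Iic.1 hk).trans hdim
      simpa [Nat.lt_succ_iff] using this
    _ ≤ _ := sum_range_choose_le_pow _ _

/-- A class formed by applying a pointwise rule to `K` members of `C` has at most `M ^ K` traces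
when `C` has at most `M`. -/
theorem TraceBound.combine {X : Type*} {C : Set (X → Bool)} {ι : Type*} [Finite ι] {M : ℕ}
    (h : TraceBound C ι M) (K : ℕ) (ψ : X → (Fin K → Bool) → Bool) :
    TraceBound {g | ∃ c : Fin K → X → Bool, (∀ k, c k ∈ C) ∧ g = fun x => ψ x fun k => c k x}
      ι (M ^ K) := by
  intro w
  set T : Set (ι → Bool) := (fun c => c ∘ w) '' C
  -- The combined trace depends only on the K-tuple of traces. Since ψ also sees the point, fixed
  -- functions enter at no cost.
  have hsub : ((fun c => c ∘ w) '' {g | ∃ c : Fin K → X → Bool, (∀ k, c k ∈ C) ∧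
      g = fun x => ψ x fun k => c k x}) ⊆
      (fun (v : Fin K → ι → Bool) i => ψ (w i) fun k => v k i) '' Set.univ.pi fun _ => T := by
    rintro _ ⟨_, ⟨c, hc, rfl⟩, rfl⟩
    exact ⟨fun k => c k ∘ w, fun k _ => ⟨c k, hc k, rfl⟩, rfl⟩
  refine (Set.ncard_le_ncard hsub (Set.toFinite _)).trans
    ((Set.ncard_image_le (Set.toFinite _)).trans ?_)
  have : (Set.univ.pi fun _ : Fin K => T).ncard = T.ncard ^ K := by
    rw [← Nat.card_coe_set_eq, Nat.card_congr (Equiv.Set.univPi _), Nat.card_pi]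
    simp
  rw [this]
  exact Nat.pow_le_pow_left (h w) K

/-! ### Symmetrization by exponential moments -/

/-- The exchange of the two copies of each index in the set where `σ` holds. -/
def swapPerm {ι : Type*} (σ : ι → Bool) : Equiv.Perm (ι ⊕ ι) :=
  Function.Involutive.toPerm
    (Sum.elim (fun i => bif σ i then .inr i else .inl i) (fun i => bif σ i then .inl i else .inr i))
    (by rintro (i | i) <;> cases h : σ i <;> simp [h])

/-- The weight of a trace on a double sample: a factor `β` for each hit in the first half and a
factor `α` for each hit in the second. -/
noncomputable def weight {ι : Type*} [Fintype ι] (α β : ℝ) (t : ι ⊕ ι → Bool) : ℝ :=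
  ∏ i, (bif t (.inl i) then β else 1) * (bif t (.inr i) then α else 1)

section weight

variable {ι : Type*} [Fintype ι] {α β : ℝ}

theorem weight_nonneg (hα : 0 ≤ α) (hβ : 0 ≤ β) (t : ι ⊕ ι → Bool) : 0 ≤ weight α β t := by
  refine Finset.prod_nonneg fun i _ => mul_nonneg ?_ ?_
  · cases t (.inl i) <;> simp [hβ]
  · cases t (.inr i) <;> simp [hα]

theorem weight_le (hα : 0 ≤ α) (hβ : 0 ≤ β) (hαβ : α + β = 2) (t : ι ⊕ ι → Bool) :
    weight α β t ≤ 2 ^ Fintype.card ι := by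
  refine (Finset.prod_le_prod (g := fun _ => (2 : ℝ)) (fun i _ => mul_nonneg ?_ ?_)
    fun i _ => ?_).trans (by simp)
  · cases t (.inl i) <;> simp [hβ]
  · cases t (.inr i) <;> simp [hα]
  · cases t (.inl i) <;> cases t (.inr i) <;> simp <;> nlinarith [sq_nonneg (α - β)]

/-- The sum factors over the pairs. A pair contributes 2 with no hit, α + β = 2 with one, and 2αβ ≤
2 with both. -/
theorem sum_weight_swapPerm_le [DecidableEq ι] (hα : 0 ≤ α) (hβ : 0 ≤ β) (hαβ : α + β = 2)
    (t : ι ⊕ ι → Bool) :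
    ∑ σ : ι → Bool, weight α β (t ∘ swapPerm σ) ≤ 2 ^ Fintype.card ι := by
  let g : ι → Bool → ℝ := fun i b =>
    (bif t (bif b then .inr i else .inl i) then β else 1) *
      (bif t (bif b then .inl i else .inr i) then α else 1)
  have hg : ∀ σ : ι → Bool, weight α β (t ∘ swapPerm σ) = ∏ i, g i (σ i) := fun σ => rfl
  have h := Finset.sum_prod_piFinset (Finset.univ : Finset Bool) g
  rw [Fintype.piFinset_univ] at h
  simp_rw [hg]
  rw [h]
  refine (Finset.prod_le_prod (g := fun _ => (2 : ℝ)) (fun i _ => ?_) fun i _ => ?_).trans (by simp)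
  · refine Finset.sum_nonneg fun b _ => mul_nonneg ?_ ?_
    · cases t (bif b then .inr i else .inl i) <;> simp [hβ]
    · cases t (bif b then .inl i else .inr i) <;> simp [hα]
  · simp only [Fintype.sum_bool, g, cond_true, cond_false]
    cases t (.inl i) <;> cases t (.inr i) <;> simp <;> nlinarith [sq_nonneg (α - β)]

end weight

theorem measurePreserving_comp_perm {X ι : Type*} [Fintype ι] [MeasurableSpace X] (P : Measure X)
    [SigmaFinite P] (e : Equiv.Perm ι) :
    MeasurePreserving (fun w : ι → X => w ∘ e) (Measure.pi fun _ => P) (Measure.pi fun _ => P) :=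
  measurePreserving_arrowCongr' (fun _ => P) (fun _ => P) e.symm (MeasurableEquiv.refl X)
    fun _ => MeasurePreserving.id P

theorem integrable_of_bounded {Y : Type*} [Countable Y] [MeasurableSpace Y]
    [DiscreteMeasurableSpace Y] (μ : Measure Y) [IsFiniteMeasure μ] (F : Y → ℝ) (c : ℝ)
    (h0 : ∀ y, 0 ≤ F y) (hc : ∀ y, F y ≤ c) : Integrable F μ :=
  Integrable.of_bound AEStronglyMeasurable.of_discrete c
    (Filter.Eventually.of_forall fun y => by rw [Real.norm_of_nonneg (h0 y)]; exact hc y)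

/-- The ghost points are independent, so the expectation of the product factors. -/
theorem integral_weight {X : Type*} [Countable X] [MeasurableSpace X]
    [DiscreteMeasurableSpace X] {n : ℕ} (P : Measure X) [IsProbabilityMeasure P] (α β : ℝ)
    (G : X → Bool) (x : Fin n → X) :
    ∫ x' : Fin n → X, weight α β (G ∘ Sum.elim x x') ∂(Measure.pi fun _ => P) =
      β ^ (Finset.univ.filter fun i => G (x i) = true).card *
        (1 + (α - 1) * P.real {u | G u = true}) ^ n := by
  have h1 : ∀ x' : Fin n → X, weight α β (G ∘ Sum.elim x x') =
      (∏ i, bif G (x i) then β else 1) * ∏ i, (bif G (x' i) then α else 1) := fun x' => by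
    simp [weight, Finset.prod_mul_distrib]
  simp_rw [h1]
  rw [integral_const_mul]
  congr 1
  · simp only [Bool.cond_eq_ite]
    rw [Finset.prod_ite]
    simp
  · rw [integral_fintype_prod_eq_prod (fun (_ : Fin n) (u : X) => bif G u then α else 1)]
    have h2 : ∀ u, (bif G u then α else 1) =
        1 + (α - 1) * Set.indicator {u | G u = true} (fun _ => (1 : ℝ)) u := fun u => by
      by_cases h : G u = true <;> simp [h]
    simp_rw [h2]
    have hs : MeasurableSet {u | G u = true} := MeasurableSet.of_discrete
    rw [integral_add (integrable_const _), integral_const_mul, integral_indicator_const _ hs]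
    · simp
    · exact ((integrable_const _).indicator hs).const_mul _

/-- Symmetrization with a ghost sample: if every sample in `B` admits a member of `𝒢` of large
weighted deviation `R`, then the probability of `B` is at most the trace bound divided by `R`. -/
theorem measureReal_mul_le_of_traceBound {X : Type*} [Countable X] [MeasurableSpace X]
    [DiscreteMeasurableSpace X] {n M : ℕ} {𝒢 : Set (X → Bool)}
    (h𝒢 : TraceBound 𝒢 (Fin n ⊕ Fin n) M) (P : Measure X) [IsProbabilityMeasure P]
    {α β R : ℝ} (hα : 0 ≤ α) (hβ : 0 ≤ β) (hαβ : α + β = 2) (B : Set (Fin n → X))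
    (hB : ∀ x ∈ B, ∃ G ∈ 𝒢, R ≤ β ^ (Finset.univ.filter fun i => G (x i) = true).card *
      (1 + (α - 1) * P.real {u | G u = true}) ^ n) :
    (Measure.pi fun _ : Fin n => P).real B * R ≤ M := by
  classical
  have hB' : ∀ x, ∃ G : X → Bool, x ∈ B → G ∈ 𝒢 ∧
      R ≤ β ^ (Finset.univ.filter fun i => G (x i) = true).card *
        (1 + (α - 1) * P.real {u | G u = true}) ^ n := fun x => by
    by_cases hx : x ∈ B
    · obtain ⟨G, h1, h2⟩ := hB x hx
      exact ⟨G, fun _ => ⟨h1, h2⟩⟩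
    · exact ⟨fun _ => false, fun h => absurd h hx⟩
  choose G hG using hB'
  let F : (Fin n ⊕ Fin n → X) → ℝ := fun w =>
    if w ∘ Sum.inl ∈ B then weight α β (G (w ∘ Sum.inl) ∘ w) else 0
  have hF0 : ∀ w, 0 ≤ F w := fun w => by
    simp only [F]; split_ifs
    · exact weight_nonneg hα hβ _
    · exact le_rfl
  have hFle : ∀ w, F w ≤ 2 ^ n := fun w => by
    simp only [F]; split_ifs
    · simpa using weight_le hα hβ hαβ (G (w ∘ Sum.inl) ∘ w)
    · positivity
  have hFint : ∀ (σ : Fin n → Bool),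
      Integrable (fun w => F (w ∘ swapPerm σ)) (Measure.pi fun _ : Fin n ⊕ Fin n => P) :=
    fun σ => integrable_of_bounded _ _ _ (fun w => hF0 _) fun w => hFle _
  have hswap : ∀ w, ∑ σ : Fin n → Bool, F (w ∘ swapPerm σ) ≤ M * 2 ^ n := fun w => by
    set T : Finset (Fin n ⊕ Fin n → Bool) := (Set.toFinite ((fun c => c ∘ w) '' 𝒢)).toFinset
      with hT
    -- The selected `G` varies with σ, but its trace on the unswapped `w` stays in the fixed set
    -- `T`; this is the union bound.
    have hle : ∀ σ, F (w ∘ swapPerm σ) ≤ ∑ t ∈ T, weight α β (t ∘ swapPerm σ) := fun σ => by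
      simp only [F]; split_ifs with hx
      · refine Finset.single_le_sum (f := fun t => weight α β (t ∘ swapPerm σ))
          (a := G ((w ∘ swapPerm σ) ∘ Sum.inl) ∘ w) (fun t _ => weight_nonneg hα hβ _) ?_
        rw [hT, Set.Finite.mem_toFinset]
        exact ⟨_, (hG _ hx).1, rfl⟩
      · exact Finset.sum_nonneg fun t _ => weight_nonneg hα hβ _
    calc ∑ σ : Fin n → Bool, F (w ∘ swapPerm σ)
        ≤ ∑ σ : Fin n → Bool, ∑ t ∈ T, weight α β (t ∘ swapPerm σ) :=
          Finset.sum_le_sum fun σ _ => hle σ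
      _ = ∑ t ∈ T, ∑ σ : Fin n → Bool, weight α β (t ∘ swapPerm σ) := Finset.sum_comm
      _ ≤ ∑ t ∈ T, 2 ^ n := Finset.sum_le_sum fun t _ => by
          simpa using sum_weight_swapPerm_le hα hβ hαβ t
      _ = T.card * 2 ^ n := by simp
      _ ≤ M * 2 ^ n := by
          have : T.card ≤ M := by
            rw [hT, ← Set.ncard_eq_toFinset_card]
            exact h𝒢 w
          gcongr
  have hupper : ∫ w, F w ∂(Measure.pi fun _ : Fin n ⊕ Fin n => P) ≤ M := by
    have hinv : ∀ σ : Fin n → Bool, ∫ w, F (w ∘ swapPerm σ) ∂(Measure.pi fun _ => P) =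
        ∫ w, F w ∂(Measure.pi fun _ : Fin n ⊕ Fin n => P) := fun σ => by
      have hmp := measurePreserving_comp_perm P (swapPerm σ)
      conv_rhs => rw [← hmp.map_eq]
      rw [integral_map hmp.measurable.aemeasurable AEStronglyMeasurable.of_discrete]
    have h1 : ∫ w, ∑ σ : Fin n → Bool, F (w ∘ swapPerm σ) ∂(Measure.pi fun _ => P) ≤
        ∫ _, (M * 2 ^ n : ℝ) ∂(Measure.pi fun _ : Fin n ⊕ Fin n => P) :=
      integral_mono (integrable_finsetSum _ fun σ _ => hFint σ) (integrable_const _) hswap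
    rw [integral_finsetSum _ fun σ _ => hFint σ] at h1
    simp_rw [hinv] at h1
    simp only [Finset.sum_const, Finset.card_univ, Fintype.card_fun, Fintype.card_bool,
      Fintype.card_fin, nsmul_eq_mul, integral_const, probReal_univ, smul_eq_mul, one_mul,
      Nat.cast_pow, Nat.cast_ofNat] at h1
    rw [mul_comm] at h1
    exact le_of_mul_le_mul_right h1 (by positivity)
  have hmp := measurePreserving_sumPiEquivProdPi_symm (fun _ : Fin n ⊕ Fin n => P)
  have hprod : ∫ w, F w ∂(Measure.pi fun _ : Fin n ⊕ Fin n => P) =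
      ∫ x, ∫ x', F (Sum.elim x x') ∂(Measure.pi fun _ : Fin n => P)
        ∂(Measure.pi fun _ : Fin n => P) := by
    rw [← hmp.integral_comp', integral_prod]
    · refine integral_congr_ae (Filter.Eventually.of_forall fun x => ?_)
      refine integral_congr_ae (Filter.Eventually.of_forall fun x' => ?_)
      simp only
      congr 1
    · exact integrable_of_bounded _ _ _ (fun w => hF0 _) fun w => hFle _
  rw [hprod] at hupper
  -- Lower bound for the same integral: for x in `B` the inner integral over the ghost sample is at
  -- least `R`.
  refine le_trans ?_ hupper
  have hBm : MeasurableSet B := MeasurableSet.of_discrete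
  rw [← smul_eq_mul, ← integral_indicator_const R hBm]
  refine integral_mono ((integrable_const R).indicator hBm)
    (integrable_of_bounded _ _ (2 ^ n) (fun x => integral_nonneg fun x' => hF0 _) fun x => ?_)
    fun x => ?_
  · refine (integral_mono (integrable_of_bounded _ _ _ (fun w => hF0 _) fun w => hFle _)
      (integrable_const (2 ^ n : ℝ)) fun x' => hFle _).trans (by simp)
  · by_cases hx : x ∈ B
    · have : ∀ x', F (Sum.elim x x') = weight α β (G x ∘ Sum.elim x x') := fun x' => by
        simp [F, hx]
      simp only [this, integral_weight]
      rw [Set.indicator_of_mem hx]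
      exact (hG x hx).2
    · rw [Set.indicator_of_notMem hx]
      exact integral_nonneg fun x' => hF0 _

/-! ### The run of the algorithm -/

variable {X : Type*} {n : ℕ}

theorem mistakes_eq_zero_iff {c : X → Bool} {l : List (X × Bool)} :
    mistakes c l = 0 ↔ ∀ p ∈ l, c p.1 = p.2 := by
  simp [mistakes, List.countP_eq_zero]

/-- On realizable data an ERM oracle returns a consistent classifier. -/
theorem IsERM.consistent {C : Set (X → Bool)} {erm : List (X × Bool) → X → Bool}
    (herm : IsERM C erm) {f : X → Bool} (hf : f ∈ C) (x : Fin n → X) (i : Fin n) :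
    erm (List.ofFn fun i => (x i, f (x i))) (x i) = f (x i) := by
  set data := List.ofFn fun i => (x i, f (x i)) with hdata
  have h0 : mistakes f data = 0 := mistakes_eq_zero_iff.2 fun p hp => by
    rw [hdata, List.mem_ofFn] at hp
    obtain ⟨j, rfl⟩ := hp
    rfl
  have h1 : mistakes (erm data) data = 0 := by
    have := (herm data).2 f hf
    omega
  exact mistakes_eq_zero_iff.1 h1 (x i, f (x i)) (by rw [hdata, List.mem_ofFn]; exact ⟨i, rfl⟩)

theorem empErr_nonneg (z : Fin n → X) (h : X → Bool) (S : Set X) (g : X → Bool) :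
    0 ≤ empErr z h S g := by
  unfold empErr; positivity

theorem empErr_le_one (z : Fin n → X) (h : X → Bool) (S : Set X) (g : X → Bool) :
    empErr z h S g ≤ 1 := by
  classical
  unfold empErr
  rw [one_div_mul_eq_div]
  refine div_le_one_of_le₀ ?_ (Nat.cast_nonneg n)
  exact_mod_cast (Finset.card_filter_le _ _).trans (by simp)

theorem empErr_univ_eq_zero {z : Fin n → X} {h g : X → Bool} (hz : ∀ i, g (z i) = h (z i)) :
    empErr z h Set.univ g = 0 := by
  simp [empErr, hz]

theorem one_div_le_empErr {z : Fin n → X} {h g : X → Bool} {S : Set X} {i : Fin n}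
    (hi : g (z i) ≠ h (z i)) (hS : z i ∈ S) : 1 / (n : ℝ) ≤ empErr z h S g := by
  classical
  unfold empErr
  refine le_mul_of_one_le_right (by positivity) ?_
  have : 0 < (Finset.univ.filter fun i => g (z i) ≠ h (z i) ∧ z i ∈ S).card :=
    Finset.card_pos.2 ⟨i, by simp [hi, hS]⟩
  exact_mod_cast this

theorem choices_subset {C : Set (X → Bool)} {Λ : ℝ} {pick : Rule X n}
    (hpick : IsMaximizing C Λ pick) (x x' : Fin n → X) (h : X → Bool) (t : ℕ) :
    ∀ c ∈ choices pick x x' h t, c ∈ C := by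
  induction t with
  | zero => simp [choices]
  | succ t ih =>
    intro c hc
    rw [choices, List.mem_append, List.mem_singleton] at hc
    rcases hc with hc | rfl
    · exact ih c hc
    · exact (hpick _ _ _ _).1

theorem length_choices (pick : Rule X n) (x x' : Fin n → X) (h : X → Bool) (t : ℕ) :
    (choices pick x x' h t).length = t := by
  induction t with
  | zero => rfl
  | succ t ih => simp [choices, ih]

theorem agreeSet_append_singleton (h : X → Bool) (cs : List (X → Bool)) (c : X → Bool) :
    agreeSet h (cs ++ [c]) = agreeSet h cs ∩ {u | c u = h u} := by
  ext u
  simp [agreeSet, or_imp, forall_and]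

/-- While the loop runs, the selection set retains all training points. -/
theorem train_mem_agreeSet {pick : Rule X n} {ε : ℝ} (hε : 0 ≤ ε) {x x' : Fin n → X}
    {h : X → Bool} {t : ℕ} (ht : ∀ s < t, ¬ Stops pick ((n : ℝ) + 1) ε x x' h s) (i : Fin n) :
    x i ∈ agreeSet h (choices pick x x' h t) := by
  induction t with
  | zero => simp [choices, agreeSet]
  | succ t ih =>
    rw [choices, agreeSet_append_singleton]
    refine ⟨ih fun s hs => ht s (by omega), ?_⟩
    -- A disagreement at `x i` costs at least (n + 1) / n > 1, so the score would be negative and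
    -- the loop would have stopped.
    by_contra hne
    refine ht t (by omega) ?_
    have h1 := one_div_le_empErr (z := x) (h := h) (S := Set.univ) hne trivial
    have h2 := empErr_le_one x' h (agreeSet h (choices pick x x' h t))
      (pick x x' h (choices pick x x' h t))
    have hn : (0 : ℝ) < n := by exact_mod_cast i.pos
    have h3 : ((n : ℝ) + 1) * (1 / n) ≤ ((n : ℝ) + 1) *
      empErr x h Set.univ (pick x x' h (choices pick x x' h t)) := by gcongr
    have h4 : (1 : ℝ) ≤ ((n : ℝ) + 1) * (1 / n) := by
      rw [mul_one_div, le_div_iff₀ hn]; linarith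
    unfold Stops score
    linarith

/-- Every unsuccessful iteration removes more than an `ε` fraction of the test points. -/
theorem iterations_mul_le_one {pick : Rule X n} {ε : ℝ} {x x' : Fin n → X} {h : X → Bool}
    {t : ℕ} (ht : ∀ s < t, ¬ Stops pick ((n : ℝ) + 1) ε x x' h s) : t * ε ≤ 1 := by
  classical
  suffices H : t * ε ≤ (1 / (n : ℝ)) *
      (Finset.univ.filter fun i => x' i ∉ agreeSet h (choices pick x x' h t)).card by
    refine H.trans ?_
    rw [one_div_mul_eq_div]
    refine div_le_one_of_le₀ ?_ (Nat.cast_nonneg n)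
    exact_mod_cast (Finset.card_filter_le _ _).trans (by simp)
  induction t with
  | zero => simp only [CharP.cast_eq_zero, zero_mul]; positivity
  | succ t ih =>
    have h1 := ih fun s hs => ht s (by omega)
    have h2 := ht t (by omega)
    unfold Stops score at h2
    set cs := choices pick x x' h t with hcs
    set c := pick x x' h cs
    have h3 : 0 ≤ ((n : ℝ) + 1) * empErr x h Set.univ c :=
      mul_nonneg (by positivity) (empErr_nonneg _ _ _ _)
    have h4 : ε ≤ empErr x' h (agreeSet h cs) c := by linarith [not_le.1 h2]
    have h5 : (Finset.univ.filter fun i => x' i ∉ agreeSet h (choices pick x x' h (t + 1))).card =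
        (Finset.univ.filter fun i => x' i ∉ agreeSet h cs).card +
        (Finset.univ.filter fun i => c (x' i) ≠ h (x' i) ∧ x' i ∈ agreeSet h cs).card := by
      rw [← Finset.card_union_of_disjoint]
      · congr 1
        ext i
        simp only [choices, agreeSet_append_singleton, ← hcs, Finset.mem_filter, Finset.mem_univ,
          true_and, Finset.mem_union, Set.mem_inter_iff, Set.mem_ofPred_eq]
        tauto
      · rw [Finset.disjoint_filter]
        tauto
    rw [h5]
    unfold empErr at h4
    push_cast
    rw [mul_add]
    have : ((t : ℝ) + 1) * ε = t * ε + ε := by ring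
    rw [this]
    refine add_le_add h1 (h4.trans (le_of_eq ?_))
    congr! 3

/-- For a positive error parameter Rejectron halts. Its output is the agreement set of the ERM
classifier with at most `1 / ε` choices, it retains the training points, and its selective error on
the test sample with respect to the target is at most `ε`. -/
theorem rejectron_spec {C : Set (X → Bool)} {erm : List (X × Bool) → X → Bool}
    (herm : IsERM C erm) {pick : Rule X n} (hpick : IsMaximizing C ((n : ℝ) + 1) pick)
    {f : X → Bool} (hf : f ∈ C) {ε : ℝ} (hε : 0 < ε) (x x' : Fin n → X) {h : X → Bool}
    (hh : h = erm (List.ofFn fun i => (x i, f (x i)))) :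
    ∃ cs : List (X → Bool),
      (h, agreeSet h cs) ∈ rejectron erm pick ((n : ℝ) + 1) x (fun i => f (x i)) x' ε ∧
      (∀ c ∈ cs, c ∈ C) ∧ cs.length ≤ ⌊1 / ε⌋₊ ∧ (∀ i, x i ∈ agreeSet h cs) ∧
      empErr x' h (agreeSet h cs) f ≤ ε := by
  classical
  have H : ∃ t, Stops pick ((n : ℝ) + 1) ε x x' h t := by
    by_contra hcon
    push Not at hcon
    obtain ⟨t, ht⟩ := exists_nat_gt (1 / ε)
    have := iterations_mul_le_one (t := t) fun s _ => hcon s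
    rw [div_lt_iff₀ hε] at ht
    linarith
  have hmin : ∀ s < Nat.find H, ¬ Stops pick ((n : ℝ) + 1) ε x x' h s :=
    fun s hs => Nat.find_min H hs
  refine ⟨choices pick x x' h (Nat.find H), ?_, choices_subset hpick _ _ _ _, ?_,
    train_mem_agreeSet hε.le hmin, ?_⟩
  · subst hh
    refine ⟨H, ?_⟩
    simp only [rejectron]
  · rw [length_choices]
    refine Nat.le_floor ?_
    rw [le_div_iff₀ hε]
    exact iterations_mul_le_one hmin
  · have h1 := Nat.find_spec H
    have h2 := (hpick x x' h (choices pick x x' h (Nat.find H))).2 f hf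
    -- By consistency `f` pays no penalty, so its score is its test disagreement with `h` on the
    -- selection set, and the maximum is at most ε.
    have h3 : empErr x h Set.univ f = 0 :=
      empErr_univ_eq_zero fun i => by rw [hh, herm.consistent hf x i]
    unfold Stops at h1
    have h4 := h2.trans h1
    unfold score at h4
    rw [h3] at h4
    linarith

/-! ### Bounds on the failure probabilities -/

/-- A list of at most `K` classifiers can be padded to a family indexed by `Fin K`. -/
theorem exists_family_of_list {C : Set (X → Bool)} {h : X → Bool} (hh : h ∈ C)
    {cs : List (X → Bool)} (hcs : ∀ c ∈ cs, c ∈ C) {K : ℕ} (hK : cs.length ≤ K) :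
    ∃ c : Fin K → X → Bool, (∀ k, c k ∈ C) ∧ ∀ u, u ∈ agreeSet h cs ↔ ∀ k, c k u = h u := by
  -- Padding with `h` itself adds no constraint to the agreement set.
  refine ⟨fun k => cs.getD k h, fun k => ?_, fun u => ⟨fun hu k => ?_, fun hu c hc => ?_⟩⟩
  · simp only [List.getD_eq_getElem?_getD]
    rcases lt_or_ge k.1 cs.length with hk | hk
    · simpa [hk] using hcs _ (List.getElem_mem hk)
    · simpa [hk] using hh
  · simp only [List.getD_eq_getElem?_getD]
    rcases lt_or_ge k.1 cs.length with hk | hk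
    · simpa [hk] using hu _ (List.getElem_mem hk)
    · simp [hk]
  · obtain ⟨k, hk, rfl⟩ := List.getElem_of_mem hc
    simpa [hk] using hu ⟨k, hk.trans_le hK⟩

theorem traceBound_sample {C : Set (X → Bool)} {d : ℕ} (hd : vcDim C = (d : ℕ∞)) (n : ℕ) :
    TraceBound C (Fin n ⊕ Fin n) ((2 * n + 1) ^ d) := by
  have := traceBound_of_vcDim hd (Fin n ⊕ Fin n)
  rwa [Fintype.card_sum, Fintype.card_fin, ← two_mul] at this

/-- Bernoulli's inequality for exponents in [0, 1]; it makes the expected ghost weight exponential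
in n q. -/
theorem rpow_le_one_add_pow {α p q : ℝ} (hα : 1 ≤ α) (hq : q ≤ p) (hp0 : 0 ≤ p) (hp1 : p ≤ 1)
    (n : ℕ) : α ^ (n * q) ≤ (1 + (α - 1) * p) ^ n := by
  have h1 : α ^ p ≤ 1 + p * (α - 1) := by
    have := rpow_one_add_le_one_add_mul_self (s := α - 1) (by linarith) hp0 hp1
    simpa using this
  calc α ^ (n * q) ≤ α ^ (n * p) := by gcongr
    _ = (α ^ p) ^ n := by rw [mul_comm, Real.rpow_mul_natCast (by linarith)]
    _ ≤ _ := by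
      refine pow_le_pow_left₀ (by positivity) (h1.trans (le_of_eq (by ring))) n

/-- The rejection guarantee of Rejectron, as a bound on the failure probability. -/
theorem rejection_failure_le [Countable X] [MeasurableSpace X] [DiscreteMeasurableSpace X]
    {C : Set (X → Bool)} {d : ℕ} (hd : vcDim C = (d : ℕ∞)) (hn : 1 ≤ n)
    {erm : List (X × Bool) → X → Bool} (herm : IsERM C erm)
    {pick : Rule X n} (hpick : IsMaximizing C ((n : ℝ) + 1) pick)
    {f : X → Bool} (hf : f ∈ C) (P : Measure X) [IsProbabilityMeasure P]
    {δ : ℝ} (hδ : 0 < δ) (hδ1 : δ ≤ 1) {ε : ℝ} (hε : 0 < ε) :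
    (Measure.pi fun _ : Fin n => P).real
      {x : Fin n → X | ∀ x' : Fin n → X,
        ∃ h S, (h, S) ∈ rejectron erm pick ((n : ℝ) + 1) x (fun i => f (x i)) x' ε ∧
          rej P S ≤ 2 / n * (2 * d / ε * Real.logb 2 (2 * n) + Real.logb 2 (2 / δ))}ᶜ ≤ δ := by
  classical
  set γ : ℝ := 2 / n * (2 * d / ε * Real.logb 2 (2 * n) + Real.logb 2 (2 / δ)) with hγ
  set B := {x : Fin n → X | ∀ x' : Fin n → X,
        ∃ h S, (h, S) ∈ rejectron erm pick ((n : ℝ) + 1) x (fun i => f (x i)) x' ε ∧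
          rej P S ≤ γ}ᶜ with hBdef
  have hn1 : (1 : ℝ) ≤ n := by exact_mod_cast hn
  have hlog2n : 0 ≤ Real.logb 2 (2 * n) := Real.logb_nonneg (by norm_num) (by linarith)
  have hlogδ : 0 ≤ Real.logb 2 (2 / δ) :=
    Real.logb_nonneg (by norm_num) (by rw [le_div_iff₀ hδ]; linarith)
  have hγ0 : 0 ≤ γ := by positivity
  -- For ε > 1 nothing is chosen or rejected; otherwise K + 1 ≤ 2 / ε is available.
  rcases lt_or_ge 1 ε with hε1 | hε1
  · have hK : ⌊1 / ε⌋₊ = 0 := Nat.floor_eq_zero.2 (by rw [div_lt_one hε]; exact hε1)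
    have : B = ∅ := by
      rw [hBdef, Set.compl_empty_iff, Set.eq_univ_iff_forall]
      intro x x'
      obtain ⟨cs, h1, -, h3, -, -⟩ := rejectron_spec herm hpick hf hε x x' rfl
      rw [hK, Nat.le_zero, List.length_eq_zero_iff] at h3
      subst h3
      refine ⟨_, _, h1, ?_⟩
      simpa [rej, agreeSet] using hγ0
    rw [this]
    simpa using hδ.le
  set K := ⌊1 / ε⌋₊ with hK
  have hK1 : (K : ℝ) ≤ 1 / ε := Nat.floor_le (by positivity)
  have hK2 : (K : ℝ) + 1 ≤ 2 / ε := by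
    have : 1 ≤ 1 / ε := by rw [le_div_iff₀ hε]; linarith
    have : 2 / ε = 1 / ε + 1 / ε := by ring
    linarith
  -- Here `h` varies with the sample, hence K + 1 functions. The hits are the rejected points; none
  -- is a training point, so β = 0 loses nothing (0 ^ 0 = 1).
  have hmain := measureReal_mul_le_of_traceBound (R := 2 ^ (n * γ))
    ((traceBound_sample hd n).combine (K + 1) fun _ v => decide (∃ k, v k ≠ v 0))
    P (α := 2) (β := 0) (by norm_num) le_rfl (by norm_num) B (by
      intro x hx
      simp only [hBdef, Set.mem_compl_iff, Set.mem_ofPred_eq, not_forall] at hx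
      obtain ⟨x', hx'⟩ := hx
      obtain ⟨cs, h1, h2, h3, h4, -⟩ := rejectron_spec herm hpick hf hε x x' rfl
      set h := erm (List.ofFn fun i => (x i, f (x i))) with hh
      have hhC : h ∈ C := (herm _).1
      obtain ⟨c, hc, hcS⟩ := exists_family_of_list (K := K) hhC h2 h3
      have hrej : γ < rej P (agreeSet h cs) := by
        by_contra hcon
        exact hx' ⟨_, _, h1, not_lt.1 hcon⟩
      let c' : Fin (K + 1) → X → Bool := Fin.cons h c
      have hG : ∀ u, (decide (∃ k, c' k u ≠ c' 0 u)) = true ↔ u ∉ agreeSet h cs := fun u => by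
        rw [hcS, decide_eq_true_iff, Fin.exists_fin_succ]
        simp [c']
      refine ⟨_, ⟨c', ?_, rfl⟩, ?_⟩
      · intro k
        refine Fin.cases ?_ (fun k => ?_) k
        · simpa [c'] using hhC
        · simpa [c'] using hc k
      · simp only [hG]
        have : (Finset.univ.filter fun i => x i ∉ agreeSet h cs) = ∅ := by
          simp [h4]
        rw [this, Finset.card_empty, pow_zero, one_mul]
        exact rpow_le_one_add_pow (by norm_num) hrej.le measureReal_nonneg measureReal_le_one n)
  have hnγ : n * γ = 2 * (2 * d / ε * Real.logb 2 (2 * n)) + 2 * Real.logb 2 (2 / δ) := by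
    rw [hγ]; field_simp
  have h2n : (0 : ℝ) < 2 * n := by linarith
  have hR : (2 : ℝ) ^ (n * γ) = (2 * n : ℝ) ^ (4 * d / ε) * (2 / δ) ^ 2 := by
    rw [hnγ, Real.rpow_add (by norm_num)]
    congr 1
    · rw [show 2 * (2 * d / ε * Real.logb 2 (2 * n)) = Real.logb 2 (2 * n) * (4 * d / ε) by ring,
        Real.rpow_mul (by norm_num), Real.rpow_logb (by norm_num) (by norm_num) h2n]
    · rw [mul_comm, Real.rpow_mul (by norm_num), Real.rpow_logb (by norm_num) (by norm_num)
        (by positivity)]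
      norm_cast
  have hM : ((((2 * n + 1) ^ d) ^ (K + 1) : ℕ) : ℝ) ≤ (2 * n : ℝ) ^ (4 * d / ε) := by
    push_cast
    calc (((2 * n + 1 : ℝ) ^ d) ^ (K + 1)) ≤ (((2 * n : ℝ) ^ 2) ^ d) ^ (K + 1) := by
          gcongr; nlinarith
      _ = (2 * n : ℝ) ^ ((2 * d * (K + 1) : ℕ) : ℝ) := by
          rw [Real.rpow_natCast, ← pow_mul, ← pow_mul, mul_assoc]
      _ ≤ _ := by
          refine Real.rpow_le_rpow_of_exponent_le (by linarith) ?_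
          push_cast
          calc 2 * (d : ℝ) * (K + 1) ≤ 2 * d * (2 / ε) := by gcongr
            _ = _ := by ring
  rw [hR] at hmain
  have hA : 0 < (2 * n : ℝ) ^ (4 * d / ε) := by positivity
  set μB := (Measure.pi fun _ : Fin n => P).real B
  have h5 : μB * (2 / δ) ^ 2 ≤ 1 := by
    refine le_of_mul_le_mul_left ?_ hA
    calc _ = μB * ((2 * n : ℝ) ^ (4 * d / ε) * (2 / δ) ^ 2) := by ring
      _ ≤ _ := hmain.trans (hM.trans (by rw [mul_one]))
  rw [div_pow, mul_div_assoc', div_le_one (by positivity)] at h5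
  nlinarith [show 0 ≤ μB from measureReal_nonneg]

/-- The quadratic inequality encoded by a lower bound on the error parameter. -/
theorem le_mul_of_sqrt_add_le {d : ℕ} {L l ε : ℝ} (hn : 1 ≤ n) (hL : 0 ≤ L) (hl : 0 < l)
    (hε : √(8 * d * L / n) + 8 * l / n ≤ ε) : 0 < ε ∧ 8 * d * L / ε + 8 * l ≤ n * ε := by
  have hn0 : (0 : ℝ) < n := by exact_mod_cast hn
  set a := √(8 * d * L / n) with ha
  have ha0 : 0 ≤ a := Real.sqrt_nonneg _
  have hsq : a ^ 2 = 8 * d * L / n := Real.sq_sqrt (by positivity)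
  have hb : 0 < 8 * l / n := by positivity
  have hε0 : 0 < ε := by linarith
  refine ⟨hε0, ?_⟩
  have h1 : 8 * d * L = n * a ^ 2 := by rw [hsq]; field_simp
  have h2 : 8 * l = n * (8 * l / n) := by field_simp
  rw [h1, h2, ← sub_nonneg]
  have h3 : n * ε - (n * a ^ 2 / ε + n * (8 * l / n)) = n / ε * (ε * (ε - 8 * l / n) - a ^ 2) := by
    field_simp
    ring
  rw [h3]
  refine mul_nonneg (by positivity) ?_
  -- Both ε and ε - 8l/n are at least `a`.
  nlinarith

/-- The base 32/27 is (2/3)(4/3)², the gain when hits have frequency ε in the sample and probability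
2ε. The rate 1/6 turns the 8 of the quadratic inequality into the 4/3 needed to pay for the traces.
-/
theorem exp_le_rpow (y : ℝ) (hy : 0 ≤ y) : Real.exp (y / 6) ≤ (32 / 27 : ℝ) ^ y := by
  have h1 : Real.exp (1 / 6) ≤ 32 / 27 := by
    refine le_of_pow_le_pow_left₀ (n := 6) (by norm_num) (by norm_num) ?_
    rw [← Real.exp_nat_mul]
    norm_num
    linarith [Real.exp_one_lt_d9]
  calc Real.exp (y / 6) = Real.exp (1 / 6) ^ y := by rw [← Real.exp_mul]; ring_nf
    _ ≤ _ := Real.rpow_le_rpow (Real.exp_pos _).le h1 hy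

/-- Absorbs 2n + 1 into 2n; it rests on (5/4)³ < 4 ≤ m. -/
theorem three_mul_log_succ_le {m : ℝ} (hm : 4 ≤ m) :
    3 * Real.log (m + 1) ≤ 4 * Real.log m := by
  have h : (m + 1) ^ 3 ≤ m ^ 4 := by
    have h1 : (m + 1) ^ 3 ≤ (5 / 4 * m) ^ 3 := by gcongr; linarith
    nlinarith [mul_le_mul_of_nonneg_right hm (show 0 ≤ m ^ 3 by positivity),
      show 0 ≤ m ^ 3 by positivity]
  have := Real.log_le_log (by positivity) h
  rwa [Real.log_pow, Real.log_pow] at this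

/-- The error guarantee of Rejectron, as a bound on the failure probability. -/
theorem error_failure_le [Countable X] [MeasurableSpace X] [DiscreteMeasurableSpace X]
    {C : Set (X → Bool)} {d : ℕ} (hd : vcDim C = (d : ℕ∞)) (hn : 1 ≤ n)
    {erm : List (X × Bool) → X → Bool} (herm : IsERM C erm)
    {pick : Rule X n} (hpick : IsMaximizing C ((n : ℝ) + 1) pick)
    {f : X → Bool} (hf : f ∈ C) (Q : Measure X) [IsProbabilityMeasure Q]
    {δ : ℝ} (hδ : 0 < δ) (hδ1 : δ ≤ 1) {ε : ℝ}
    (hε : √(8 * d * Real.log (2 * n) / n) + 8 * Real.log (8 / δ) / n ≤ ε) (x : Fin n → X) :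
    (Measure.pi fun _ : Fin n => Q).real
      {x' : Fin n → X |
        ∃ h S, (h, S) ∈ rejectron erm pick ((n : ℝ) + 1) x (fun i => f (x i)) x' ε ∧
          err Q f h S ≤ 2 * ε}ᶜ ≤ δ := by
  classical
  set B := {x' : Fin n → X |
        ∃ h S, (h, S) ∈ rejectron erm pick ((n : ℝ) + 1) x (fun i => f (x i)) x' ε ∧
          err Q f h S ≤ 2 * ε}ᶜ with hBdef
  have hn1 : (1 : ℝ) ≤ n := by exact_mod_cast hn
  have hL : 0 ≤ Real.log (2 * n) := Real.log_nonneg (by linarith)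
  have hl : 1 < Real.log (8 / δ) := by
    rw [Real.lt_log_iff_exp_lt (by positivity), lt_div_iff₀ hδ]
    nlinarith [Real.exp_one_lt_d9, Real.exp_pos 1]
  obtain ⟨hε0, hquad⟩ := le_mul_of_sqrt_add_le hn hL (by linarith) hε
  set h := erm (List.ofFn fun i => (x i, f (x i))) with hh
  have hhC : h ∈ C := (herm _).1
  rcases le_or_gt (1 / 2) ε with hε1 | hε1
  · have : B = ∅ := by
      rw [hBdef, Set.compl_empty_iff, Set.eq_univ_iff_forall]
      intro x'
      obtain ⟨cs, h1, -⟩ := rejectron_spec herm hpick hf hε0 x x' rfl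
      exact ⟨_, _, h1, measureReal_le_one.trans (by linarith)⟩
    rw [this]
    simpa using hδ.le
  set K := ⌊1 / ε⌋₊ with hK
  have hK1 : (K : ℝ) ≤ 1 / ε := Nat.floor_le (by positivity)
  -- The training sample is fixed, so `h` and `f` sit in the pointwise rule and only the K choices
  -- vary.
  have hmain := measureReal_mul_le_of_traceBound (R := (32 / 27) ^ (n * ε))
    ((traceBound_sample hd n).combine K fun u v => decide (h u ≠ f u ∧ ∀ k, v k = h u))
    Q (α := 4 / 3) (β := 2 / 3) (by norm_num) (by norm_num) (by norm_num) B (by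
      intro x' hx'
      simp only [hBdef, Set.mem_compl_iff, Set.mem_ofPred_eq] at hx'
      obtain ⟨cs, h1, h2, h3, -, h5⟩ := rejectron_spec herm hpick hf hε0 x x' hh
      obtain ⟨c, hc, hcS⟩ := exists_family_of_list (K := K) hhC h2 h3
      have herr : 2 * ε < err Q f h (agreeSet h cs) := by
        by_contra hcon
        exact hx' ⟨_, _, h1, not_lt.1 hcon⟩
      have hG : ∀ u, (decide (h u ≠ f u ∧ ∀ k, c k u = h u)) = true ↔
          h u ≠ f u ∧ u ∈ agreeSet h cs := fun u => by
        rw [hcS, decide_eq_true_iff]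
      refine ⟨_, ⟨c, hc, rfl⟩, ?_⟩
      simp only [hG]
      set a := (Finset.univ.filter fun i => h (x' i) ≠ f (x' i) ∧ x' i ∈ agreeSet h cs).card
        with ha
      have haε : (a : ℝ) ≤ n * ε := by
        unfold empErr at h5
        rw [one_div_mul_eq_div, div_le_iff₀ (by linarith), mul_comm ε] at h5
        refine le_trans (le_of_eq ?_) h5
        rw [ha]
        congr! 4
        exact ne_comm
      have hβ : (2 / 3 : ℝ) ^ (n * ε) ≤ (2 / 3) ^ a := by
        rw [← Real.rpow_natCast]
        exact Real.rpow_le_rpow_of_exponent_ge (by norm_num) (by norm_num) haε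
      have hα := rpow_le_one_add_pow (α := 4 / 3) (by norm_num) herr.le
        (measureReal_nonneg (μ := Q)) measureReal_le_one n
      calc (32 / 27 : ℝ) ^ (n * ε) = (2 / 3) ^ (n * ε) * (4 / 3) ^ (n * (2 * ε)) := by
            rw [show n * (2 * ε) = ((2 : ℕ) : ℝ) * (n * ε) by push_cast; ring,
              Real.rpow_mul (x := 4 / 3) (by norm_num), Real.rpow_natCast,
              ← Real.mul_rpow (by norm_num) (by norm_num)]
            norm_num
        _ ≤ _ := mul_le_mul hβ hα (by positivity) (by positivity))
  set μB := (Measure.pi fun _ : Fin n => Q).real B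
  have hμ0 : 0 ≤ μB := measureReal_nonneg
  -- From 8 < n ε and ε < 1/2.
  have hn2 : 4 ≤ 2 * (n : ℝ) := by
    have : 0 ≤ 8 * d * Real.log (2 * n) / ε := by positivity
    nlinarith
  have hM : ((((2 * n + 1) ^ d) ^ K : ℕ) : ℝ) ≤
      Real.exp (4 / 3 * (d * Real.log (2 * n) / ε)) := by
    push_cast
    rw [← pow_mul, ← Real.exp_log (show (0 : ℝ) < 2 * n + 1 by linarith), ← Real.exp_nat_mul,
      Real.exp_le_exp]
    push_cast
    have hlog := three_mul_log_succ_le hn2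
    calc (d : ℝ) * K * Real.log (2 * n + 1) ≤ d * (1 / ε) * (4 / 3 * Real.log (2 * n)) := by
          gcongr
          · exact Real.log_nonneg (by linarith)
          · linarith
      _ = _ := by ring
  have hR : Real.exp (4 / 3 * (d * Real.log (2 * n) / ε)) * (8 / δ) ≤
      (32 / 27 : ℝ) ^ (n * ε) := by
    refine le_trans ?_ (exp_le_rpow (n * ε) (by positivity))
    rw [← Real.exp_log (show 0 < 8 / δ by positivity), ← Real.exp_add, Real.exp_le_exp]
    have : 8 * d * Real.log (2 * n) / ε = 8 * (d * Real.log (2 * n) / ε) := by ring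
    linarith
  have hE := Real.exp_pos (4 / 3 * (d * Real.log (2 * n) / ε))
  have h5 : μB * (8 / δ) ≤ 1 := by
    refine le_of_mul_le_mul_left ?_ hE
    calc _ = μB * (Real.exp (4 / 3 * (d * Real.log (2 * n) / ε)) * (8 / δ)) := by ring
      _ ≤ μB * (32 / 27 : ℝ) ^ (n * ε) := by gcongr
      _ ≤ _ := hmain.trans (hM.trans (by rw [mul_one]))
  rw [mul_div_assoc', div_le_one hδ] at h5
  linarith

/-! ### Balancing errors and rejections -/

theorem epsStar_eq (d n : ℕ) (δ : ℝ) :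
    epsStar d n δ = √(8 * d * Real.log (2 * n) / n) + 8 * Real.log (8 / (δ / 2)) / n := by
  rw [epsStar, show 8 / (δ / 2) = 16 / δ by rw [div_div_eq_mul_div]; norm_num]

theorem epsStar_pos (d : ℕ) (hn : 1 ≤ n) {δ : ℝ} (hδ : 0 < δ) (hδ1 : δ ≤ 1) :
    0 < epsStar d n δ := by
  have hl : 0 < Real.log (16 / δ) := Real.log_pos (by rw [lt_div_iff₀ hδ]; linarith)
  have hn0 : (0 : ℝ) < n := by exact_mod_cast hn
  unfold epsStar
  positivity

/-- The balanced error parameter dominates the corresponding bound on the rejection rate. -/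
theorem rejection_bound_le_epsStar (d : ℕ) (hn : 1 ≤ n) {δ : ℝ} (hδ : 0 < δ) (hδ1 : δ ≤ 1) :
    2 / n * (2 * d / epsStar d n δ * Real.logb 2 (2 * n) + Real.logb 2 (2 / (δ / 2))) ≤
      epsStar d n δ := by
  have hn1 : (1 : ℝ) ≤ n := by exact_mod_cast hn
  have hL : 0 ≤ Real.log (2 * n) := Real.log_nonneg (by linarith)
  have hl : 0 < Real.log (8 / (δ / 2)) :=
    Real.log_pos (by rw [lt_div_iff₀ (by positivity)]; linarith)
  obtain ⟨hε0, hquad⟩ := le_mul_of_sqrt_add_le hn hL hl (epsStar_eq d n δ).ge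
  set ε := epsStar d n δ
  have hl' : Real.log (2 / (δ / 2)) ≤ Real.log (8 / (δ / 2)) :=
    Real.log_le_log (by positivity) (by gcongr; norm_num)
  have hl0 : 0 ≤ Real.log (2 / (δ / 2)) :=
    Real.log_nonneg (by rw [le_div_iff₀ (by positivity)]; linarith)
  -- Since 1 / log 2 < 2, changing base costs a factor 2, and 2 · 2 · 2 matches the 8 in `hquad`.
  have hlogb : ∀ y, 0 ≤ Real.log y → Real.logb 2 y ≤ 2 * Real.log y := fun y hy => by
    rw [Real.logb, div_le_iff₀ (Real.log_pos (by norm_num))]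
    nlinarith [Real.log_two_gt_d9]
  have h1 := hlogb _ hL
  have h2 := hlogb _ hl0
  rw [div_mul_eq_mul_div, div_le_iff₀ (by linarith), mul_comm ε]
  refine le_trans ?_ hquad
  calc 2 * (2 * d / ε * Real.logb 2 (2 * n) + Real.logb 2 (2 / (δ / 2)))
      ≤ 2 * (2 * d / ε * (2 * Real.log (2 * n)) + 2 * Real.log (8 / (δ / 2))) := by
        gcongr; linarith
    _ = 8 * d * Real.log (2 * n) / ε + 4 * Real.log (8 / (δ / 2)) := by ring
    _ ≤ _ := by linarith

theorem one_sub_le_measureReal_of_compl_le {Y : Type*} [MeasurableSpace Y]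
    [DiscreteMeasurableSpace Y] (μ : Measure Y) [IsProbabilityMeasure μ] {S : Set Y} {δ : ℝ}
    (h : μ.real Sᶜ ≤ δ) : 1 - δ ≤ μ.real S := by
  rw [probReal_compl_eq_one_sub MeasurableSet.of_discrete] at h
  linarith

/-- A bound on all sections bounds the measure of a set in a product. -/
theorem measureReal_prod_le {Y Z : Type*} [MeasurableSpace Y] [MeasurableSpace Z]
    [Countable Y] [Countable Z] [DiscreteMeasurableSpace Y] [DiscreteMeasurableSpace Z]
    (μ : Measure Y) (ν : Measure Z) [IsProbabilityMeasure μ] [IsProbabilityMeasure ν]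
    (A : Set (Y × Z)) {δ : ℝ} (hδ : 0 ≤ δ) (h : ∀ y, ν.real (Prod.mk y ⁻¹' A) ≤ δ) :
    (μ.prod ν).real A ≤ δ := by
  refine ENNReal.toReal_le_of_le_ofReal hδ ?_
  rw [Measure.prod_apply MeasurableSet.of_discrete]
  calc ∫⁻ y, ν (Prod.mk y ⁻¹' A) ∂μ ≤ ∫⁻ _, ENNReal.ofReal δ ∂μ := lintegral_mono fun y =>
        (ENNReal.le_ofReal_iff_toReal_le (measure_ne_top _ _) hδ).2 (h y)
    _ = ENNReal.ofReal δ := by simp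

end PQ

theorem theorem5p2 {X : Type*} [Countable X] [MeasurableSpace X] [DiscreteMeasurableSpace X]
    (C : Set (X → Bool)) (d : ℕ) (hd : PQ.vcDim C = (d : ℕ∞))
    (n : ℕ) (hn : 1 ≤ n)
    (erm : List (X × Bool) → X → Bool) (herm : PQ.IsERM C erm)
    (pick : PQ.Rule X n) (hpick : PQ.IsMaximizing C ((n : ℝ) + 1) pick)
    (f : X → Bool) (hf : f ∈ C)
    (P Q : Measure X) [IsProbabilityMeasure P] [IsProbabilityMeasure Q]
    (δ : ℝ) (hδ : 0 < δ) :
    -- the guarantee with the balanced error parameter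
    (1 - δ ≤ ((Measure.pi fun _ : Fin n => P).prod (Measure.pi fun _ : Fin n => Q)).real
      {z : (Fin n → X) × (Fin n → X) |
        ∃ h S, (h, S) ∈ PQ.rejectron erm pick ((n : ℝ) + 1) z.1 (fun i => f (z.1 i)) z.2
            (PQ.epsStar d n δ) ∧
          PQ.err Q f h S ≤ 2 * PQ.epsStar d n δ ∧ PQ.rej P S ≤ PQ.epsStar d n δ}) ∧
    -- the general trade-off: errors
    (∀ ε : ℝ, √(8 * d * Real.log (2 * n) / n) + 8 * Real.log (8 / δ) / n ≤ ε →
      ∀ x : Fin n → X,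
        1 - δ ≤ (Measure.pi fun _ : Fin n => Q).real
          {x' : Fin n → X |
            ∃ h S, (h, S) ∈ PQ.rejectron erm pick ((n : ℝ) + 1) x (fun i => f (x i)) x' ε ∧
              PQ.err Q f h S ≤ 2 * ε}) ∧
    -- the general trade-off: rejections
    (∀ ε : ℝ, 0 < ε →
      1 - δ ≤ (Measure.pi fun _ : Fin n => P).real
        {x : Fin n → X | ∀ x' : Fin n → X,
          ∃ h S, (h, S) ∈ PQ.rejectron erm pick ((n : ℝ) + 1) x (fun i => f (x i)) x' ε ∧
            PQ.rej P S ≤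
              2 / n * (2 * d / ε * Real.logb 2 (2 * n) + Real.logb 2 (2 / δ))}) := by
  rcases le_or_gt 1 δ with hδ1 | hδ1
  · exact ⟨(by linarith : 1 - δ ≤ 0).trans measureReal_nonneg,
      fun ε _ x => (by linarith : 1 - δ ≤ 0).trans measureReal_nonneg,
      fun ε _ => (by linarith : 1 - δ ≤ 0).trans measureReal_nonneg⟩
  refine ⟨?_, fun ε hε x => PQ.one_sub_le_measureReal_of_compl_le _
      (PQ.error_failure_le hd hn herm hpick hf Q hδ hδ1.le hε x),
    fun ε hε => PQ.one_sub_le_measureReal_of_compl_le _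
      (PQ.rejection_failure_le hd hn herm hpick hf P hδ hδ1.le hε)⟩
  refine PQ.one_sub_le_measureReal_of_compl_le _ ?_
  have hrej := PQ.rejection_failure_le hd hn herm hpick hf P (half_pos hδ) (by linarith)
    (PQ.epsStar_pos d hn hδ hδ1.le)
  have herr := PQ.error_failure_le hd hn herm hpick hf Q (half_pos hδ) (by linarith)
    (PQ.epsStar_eq d n δ).ge
  have hle := PQ.rejection_bound_le_epsStar d hn hδ hδ1.le
  set ε := PQ.epsStar d n δ
  set A := {x : Fin n → X | ∀ x' : Fin n → X,
    ∃ h S, (h, S) ∈ PQ.rejectron erm pick ((n : ℝ) + 1) x (fun i => f (x i)) x' ε ∧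
      PQ.rej P S ≤ 2 / n * (2 * d / ε * Real.logb 2 (2 * n) + Real.logb 2 (2 / (δ / 2)))}
  let E : Set ((Fin n → X) × (Fin n → X)) := {z |
    ∃ h S, (h, S) ∈ PQ.rejectron erm pick ((n : ℝ) + 1) z.1 (fun i => f (z.1 i)) z.2 ε ∧
      PQ.err Q f h S ≤ 2 * ε}
  set μ := Measure.pi fun _ : Fin n => P
  set ν := Measure.pi fun _ : Fin n => Q
  -- The error bound holds for every fixed training sample, so it integrates over them.
  have hE : (μ.prod ν).real Eᶜ ≤ δ / 2 :=
    PQ.measureReal_prod_le μ ν Eᶜ (half_pos hδ).le fun x => herr x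
  have hA : (μ.prod ν).real (Aᶜ ×ˢ Set.univ) ≤ δ / 2 := by
    rw [measureReal_prod_prod, probReal_univ, mul_one]
    exact hrej
  refine (measureReal_mono (s₂ := Aᶜ ×ˢ Set.univ ∪ Eᶜ) ?_).trans
    ((measureReal_union_le _ _).trans (by linarith))
  intro z hz
  by_contra hcon
  simp only [Set.mem_union, Set.mem_prod, Set.mem_univ, and_true, Set.mem_compl_iff, not_or,
    not_not] at hcon
  obtain ⟨hzA, h, S, hS, hSerr⟩ := hcon
  obtain ⟨h', S', hS', hSrej⟩ := hzA z.2
  -- A partial value is unique, so both guarantees concern the same output.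
  obtain ⟨rfl, rfl⟩ := Prod.mk.inj (Part.mem_unique hS hS')
  exact hz ⟨h, S, hS, hSerr, hSrej.trans hle⟩
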